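/- Let $\mathcal A$ be a finite set of lines in the complex projective plane, let $S=\mathbb C[x,y,z]$, and let $f\in S$ be the product of linear equations of the lines of $\mathcal A$. Let $J_f\subseteq S$ be the ideal generated by $f_x,f_y,f_z$, let $\hat J_f$ be its saturation with respect to $(x,y,z)$, and let $N(f)=\hat J_f/J_f$. Assume that $\mathcal A$ is nearly free, i.e. $N(f)\neq 0$ and $\dim_{\mathbb C} N(f)_k\le 1$ for every $k$, with exponents $d_1\le d_2$; that is, the graded $S$-module $$AR(f)=\{(a,b,c)\in S^3 : a f_x+b f_y+c f_z=0\}$$ has a minimal system of homogeneous generators consisting of three relations, of degrees $d_1,d_2,d_2$ (the degree of a relation being the common degree of $a,b,c$). Then for every line $H\in\mathcal A$, the number $n_H$ of multiple points on $H$ (points of $H$ lying on at least two distinct lines of $\mathcal A$) satisfies $$n_H\le d_2+1 .$$ -/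

import Mathlib

open MvPolynomial
open scoped LinearAlgebra.Projectivization

noncomputable section

namespace LineArrangement

/-- The polynomial ring `S = ℂ[x, y, z]`, with its standard grading. -/
abbrev S : Type := MvPolynomial (Fin 3) ℂ

/-- The complex projective plane, with homogeneous coordinates. -/
abbrev Plane : Type := ℙ ℂ (Fin 3 → ℂ)

/-- A line in the complex projective plane, given by the class `[a : b : c]` of the coefficients
of an equation `a x + b y + c z = 0`. A line arrangement is a finite set of lines. -/
abbrev Line : Type := ℙ ℂ (Fin 3 → ℂ)

/-- An equation `a x + b y + c z` of a line; it is determined up to a nonzero constant factor. -/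
def Line.form (L : Line) : S := ∑ i, C (L.rep i) * X i

/-- The point `p` lies on the line `L`. -/
def Line.Through (L : Line) (p : Plane) : Prop := Projectivization.orthogonal L p

/-- A defining equation `f` of the arrangement: the product of equations of its lines. -/
def definingPoly (A : Finset Line) : S := ∏ L ∈ A, Line.form L

/-- The multiple points of `A` on the line `H`: the points of `H` that lie on at least two
distinct lines of `A`. -/
def multiplePointsOn (A : Finset Line) (H : Line) : Set Plane :=
  {p | H.Through p ∧ ∃ K ∈ A, ∃ L ∈ A, K ≠ L ∧ K.Through p ∧ L.Through p}

/-- The Jacobian ideal `J_f`, spanned by the partial derivatives of `f`. -/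
def jacobianIdeal (f : S) : Ideal S := Ideal.span (Set.range fun i => pderiv i f)

/-- The maximal ideal `(x, y, z)` of `S`. -/
def irrelevantIdeal : Ideal S := Ideal.span (Set.range X)

/-- The saturation of `J` with respect to `𝔪 = (x, y, z)`: all `g` with `𝔪 ^ n * g ⊆ J` for
some `n`. -/
def saturation (J : Ideal S) : Ideal S where
  carrier := {g | ∃ n : ℕ, ∀ h ∈ irrelevantIdeal ^ n, h * g ∈ J}
  zero_mem' := ⟨0, fun h _ => by simp⟩
  add_mem' := by
    rintro a b ⟨m, hm⟩ ⟨n, hn⟩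
    refine ⟨max m n, fun h hh => ?_⟩
    rw [mul_add]
    exact J.add_mem (hm h (Ideal.pow_le_pow_right (le_max_left m n) hh))
      (hn h (Ideal.pow_le_pow_right (le_max_right m n) hh))
  smul_mem' := by
    rintro c g ⟨n, hn⟩
    refine ⟨n, fun h hh => ?_⟩
    have key : h * (c • g) = c * (h * g) := by rw [smul_eq_mul]; ring
    rw [key]
    exact J.mul_mem_left c (hn h hh)

/-- The module `N(f)`, the quotient of the saturation of `J_f` by `J_f`, realized inside
`S ⧸ J_f`. -/
def N (f : S) : Ideal (S ⧸ jacobianIdeal f) :=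
  (saturation (jacobianIdeal f)).map (Ideal.Quotient.mk (jacobianIdeal f))

/-- The homogeneous component `N(f)_k`, a complex vector space: the classes in `S ⧸ J_f` of the
homogeneous polynomials of degree `k` in the saturation of `J_f`. -/
def gradedN (f : S) (k : ℕ) : Submodule ℂ (S ⧸ jacobianIdeal f) :=
  ((saturation (jacobianIdeal f)).restrictScalars ℂ ⊓ homogeneousSubmodule (Fin 3) ℂ k).map
    (Ideal.Quotient.mkₐ ℂ (jacobianIdeal f)).toLinearMap

/-- The arrangement `A` is nearly free: `N(f)` is nontrivial, and `dim N(f)_k ≤ 1` for all `k`. -/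
def NearlyFree (A : Finset Line) : Prop :=
  N (definingPoly A) ≠ ⊥ ∧ ∀ k : ℕ, Module.rank ℂ (gradedN (definingPoly A) k) ≤ 1

/-- The module `AR(f)` of all Jacobian relations `a f_x + b f_y + c f_z = 0`. -/
def AR (f : S) : Submodule S (Fin 3 → S) where
  carrier := {r | ∑ i, r i * pderiv i f = 0}
  zero_mem' := by simp
  add_mem' := by
    intro a b ha hb
    simp only [Set.mem_ofPred_eq] at ha hb ⊢
    simp [add_mul, Finset.sum_add_distrib, ha, hb]
  smul_mem' := by
    intro c r hr
    simp only [Set.mem_ofPred_eq] at hr ⊢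
    simp [mul_assoc, ← Finset.mul_sum, hr]

/-- `(d₁, d₂)` with `d₁ ≤ d₂` are the exponents of the (nearly free) arrangement `A`: the graded
module `AR(f)` has a minimal system of homogeneous generators consisting of three relations, of
degrees `d₁`, `d₂`, `d₂`. The degree of a relation is the common degree of its coefficients. -/
def HasNearExponents (A : Finset Line) (d₁ d₂ : ℕ) : Prop :=
  d₁ ≤ d₂ ∧ ∃ r : Fin 3 → Fin 3 → S,
    (∀ j i, (r j i).IsHomogeneous (![d₁, d₂, d₂] j)) ∧
    Submodule.span S (Set.range r) = AR (definingPoly A) ∧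
    ∀ j, r j ∉ Submodule.span S (r '' {j}ᶜ)

end LineArrangement

end

/-!
Only the degrees of the generators of `AR(f)` matter for the bound. Fix a line `H` of the
arrangement with equation `α`, and write `f = α Q`.

A relation `r ∈ AR(f)`, read as a vector field on `ℂ³`, is tangent to every line of the arrangement
(`LineArrangement.dotProduct_eval_eq_zero_of_mem_AR`). At a multiple point `p` of `H` it is tangent
to two distinct lines through `p`, so `r(p)` is proportional to `p`, that is `r(p) × p = 0`. The
coordinates of `r × (x, y, z)` are forms of degree `deg r + 1` vanishing at all multiple points of
`H`. If, for one of the generators, such a form does not vanish identically on `H`, then there are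
at most `deg r + 1 ≤ d₂ + 1` multiple points on `H`.

Otherwise all generators, hence all elements of `AR(f)`, are proportional to the radial field
`(x, y, z)` along `H`. This is impossible: for `q` on `H` the relation
`deg(f) Q q - (∂_q Q) (x, y, z)` (`LineArrangement.tangentRelation_mem_AR`) is not, at the
points of `H` lying on no other line.
-/

open Matrix MvPolynomial

namespace LineArrangement

/-! ### Vectors in three-space -/

lemma exists_smul_eq_of_cross_eq_zero {v w : Fin 3 → ℂ} (hv : v ≠ 0) (h : v ⨯₃ w = 0) :
    ∃ t : ℂ, t • v = w := by
  by_contra! hne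
  exact crossProduct_ne_zero_iff_linearIndependent.mpr
    ((LinearIndependent.pair_iff' hv).mpr hne) h

lemma cross_cross_eq_zero {a v w : Fin 3 → ℂ} (hv : a ⬝ᵥ v = 0) (hw : a ⬝ᵥ w = 0) :
    a ⨯₃ (v ⨯₃ w) = 0 := by
  rw [cross_cross_eq_smul_sub_smul', hw, dotProduct_comm v a, hv, zero_smul, zero_smul, sub_zero]

lemma cross_eq_zero_of_dotProduct_eq_zero {a b v w : Fin 3 → ℂ} (hab : a ⨯₃ b ≠ 0)
    (hav : a ⬝ᵥ v = 0) (hbv : b ⬝ᵥ v = 0) (haw : a ⬝ᵥ w = 0) (hbw : b ⬝ᵥ w = 0) :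
    v ⨯₃ w = 0 := by
  -- otherwise `a` and `b` are both multiples of `v × w`
  by_contra h
  have scalar {c : Fin 3 → ℂ} (hv : c ⬝ᵥ v = 0) (hw : c ⬝ᵥ w = 0) : ∃ t : ℂ, t • (v ⨯₃ w) = c :=
    exists_smul_eq_of_cross_eq_zero h (by rw [← cross_anticomm, cross_cross_eq_zero hv hw, neg_zero])
  obtain ⟨s, rfl⟩ := scalar hav haw
  obtain ⟨t, rfl⟩ := scalar hbv hbw
  exact hab (by simp)

/-- A plane in three-space is spanned by any two independent vectors in it. -/
lemma exists_eq_smul_add_smul {a p q v : Fin 3 → ℂ} (ha : a ≠ 0) (hpq : q ⨯₃ p ≠ 0)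
    (hp : a ⬝ᵥ p = 0) (hq : a ⬝ᵥ q = 0) (hv : a ⬝ᵥ v = 0) :
    ∃ s t : ℂ, v = s • p + t • q := by
  -- `q × p` and `v × p` are both multiples of `a`, so `(v - t q) × p = 0` for some `t`
  obtain ⟨c, hc⟩ := exists_smul_eq_of_cross_eq_zero ha (cross_cross_eq_zero hq hp)
  obtain ⟨d, hd⟩ := exists_smul_eq_of_cross_eq_zero ha (cross_cross_eq_zero hv hp)
  have hc0 : c ≠ 0 := by
    rintro rfl
    exact hpq (by rw [← hc, zero_smul])
  have hp0 : p ≠ 0 := by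
    rintro rfl
    exact hpq (map_zero _)
  have h : p ⨯₃ (v - (d / c) • q) = 0 := by
    rw [← cross_anticomm, map_sub, map_smul, LinearMap.sub_apply, LinearMap.smul_apply, ← hc, ← hd,
      smul_smul, div_mul_cancel₀ d hc0, sub_self, neg_zero]
  obtain ⟨s, hs⟩ := exists_smul_eq_of_cross_eq_zero hp0 h
  exact ⟨s, d / c, by rw [hs, sub_add_cancel]⟩

lemma exists_cross_ne_zero {a q : Fin 3 → ℂ} (ha : a ≠ 0) (hq0 : q ≠ 0) (hq : a ⬝ᵥ q = 0) :
    ∃ p, a ⬝ᵥ p = 0 ∧ q ⨯₃ p ≠ 0 := by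
  obtain ⟨i, hi⟩ := Function.ne_iff.mp hq0
  refine ⟨a ⨯₃ Pi.single i 1, dot_self_cross _ _, ?_⟩
  rw [cross_cross_eq_smul_sub_smul', hq, zero_smul, sub_zero]
  simpa using ⟨hi, ha⟩

/-! ### Points on lines -/

lemma Line.through_iff (L : Line) (p : Plane) : L.Through p ↔ L.rep ⬝ᵥ p.rep = 0 := by
  conv_lhs => rw [Line.Through, ← L.mk_rep, ← p.mk_rep]
  exact Projectivization.orthogonal_mk _ _

lemma Line.cross_rep_ne_zero {K L : Line} (h : K ≠ L) : K.rep ⨯₃ L.rep ≠ 0 := by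
  rw [Ne, ← Projectivization.mk_eq_mk_iff_crossProduct_eq_zero K.rep_nonzero L.rep_nonzero]
  simpa using h

/-- On every line there is a point that lies on no other line of the arrangement. -/
lemma exists_dotProduct_ne_zero (A : Finset Line) (H : Line) :
    ∃ q, H.rep ⬝ᵥ q = 0 ∧ ∀ L ∈ A, L ≠ H → L.rep ⬝ᵥ q ≠ 0 := by
  classical
  obtain ⟨q, hq, hne⟩ := Module.Dual.exists_forall_mem_ne_zero_of_forall_exists
    (LinearMap.ker (dotProductBilin ℂ ℂ H.rep))
    (fun L : {L // L ∈ A.erase H} => dotProductBilin ℂ ℂ L.1.rep) (by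
      rintro ⟨L, hL⟩
      obtain ⟨i, hi⟩ := Function.ne_iff.mp (Line.cross_rep_ne_zero (Finset.ne_of_mem_erase hL))
      refine ⟨H.rep ⨯₃ Pi.single i 1, by simp, ?_⟩
      have : L.rep ⬝ᵥ H.rep ⨯₃ Pi.single i 1 = (L.rep ⨯₃ H.rep) i := by
        rw [triple_product_permutation, triple_product_permutation, single_one_dotProduct]
      simpa [this] using hi)
  exact ⟨q, by simpa using hq, fun L hL hLH => hne ⟨L, Finset.mem_erase.mpr ⟨hLH, hL⟩⟩⟩

/-! ### Restriction to a parametrized line -/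

/-- The restriction of a polynomial on `ℂ³` to the affine line `t ↦ p + t q`, a polynomial
in `t`. -/
noncomputable def restrict (p q : Fin 3 → ℂ) : S →ₐ[ℂ] Polynomial ℂ :=
  aeval fun i => Polynomial.C (p i) + Polynomial.C (q i) * Polynomial.X

lemma restrict_X (p q : Fin 3 → ℂ) (i : Fin 3) :
    restrict p q (X i) = Polynomial.C (p i) + Polynomial.C (q i) * Polynomial.X := by
  simp [restrict]

lemma restrict_C (p q : Fin 3 → ℂ) (c : ℂ) : restrict p q (C c) = Polynomial.C c := by
  simp [restrict]

lemma eval_restrict (p q : Fin 3 → ℂ) (t : ℂ) (g : S) :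
    (restrict p q g).eval t = eval (p + t • q) g := by
  induction g using MvPolynomial.induction_on with
  | C c => simp [restrict]
  | add g h hg hh => simp [hg, hh]
  | mul_X g i hg => simp [hg, restrict_X, mul_comm (q i) t]

lemma restrict_form (p q : Fin 3 → ℂ) (L : Line) :
    restrict p q L.form =
      Polynomial.C (L.rep ⬝ᵥ p) + Polynomial.C (L.rep ⬝ᵥ q) * Polynomial.X := by
  simp only [Line.form, map_mul, restrict_C, restrict_X, dotProduct, Fin.sum_univ_three,
    map_add]
  ring

lemma restrict_prod_form_ne_zero {B : Finset Line} (p : Fin 3 → ℂ) {q : Fin 3 → ℂ}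
    (hq : ∀ L ∈ B, L.rep ⬝ᵥ q ≠ 0) : restrict p q (∏ L ∈ B, L.form) ≠ 0 := by
  rw [map_prod, Finset.prod_ne_zero_iff]
  intro L hL h
  apply hq L hL
  simpa [restrict_form] using congrArg (Polynomial.coeff · 1) h

lemma map_cross {R R' : Type*} [CommRing R] [CommRing R'] (φ : R →+* R') (v w : Fin 3 → R)
    (k : Fin 3) : φ ((v ⨯₃ w) k) = ((fun i => φ (v i)) ⨯₃ fun i => φ (w i)) k := by
  fin_cases k <;> simp [cross_apply]

lemma isHomogeneous_cross_X {r : Fin 3 → S} {e : ℕ} (hr : ∀ i, (r i).IsHomogeneous e)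
    (k : Fin 3) : ((r ⨯₃ (X : Fin 3 → S)) k).IsHomogeneous (e + 1) := by
  have h (i j : Fin 3) := (hr i).mul (isHomogeneous_X ℂ j)
  fin_cases k <;> simpa [cross_apply] using (h _ _).sub (h _ _)

/-! ### Jacobian relations -/

lemma mem_AR {f : S} {r : Fin 3 → S} : r ∈ AR f ↔ ∑ i, r i * pderiv i f = 0 := Iff.rfl

lemma pderiv_form (L : Line) (i : Fin 3) : pderiv i L.form = C (L.rep i) := by
  simp [Line.form, pderiv_X, Pi.single_apply]

lemma definingPoly_eq_form_mul [DecidableEq Line] {A : Finset Line} {H : Line} (hH : H ∈ A) :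
    definingPoly A = H.form * ∏ L ∈ A.erase H, L.form :=
  (Finset.mul_prod_erase A Line.form hH).symm

lemma isHomogeneous_definingPoly (A : Finset Line) : (definingPoly A).IsHomogeneous A.card := by
  have h (L : Line) : L.form.IsHomogeneous 1 :=
    IsHomogeneous.sum _ _ _ fun i _ => by
      simpa using (isHomogeneous_C (Fin 3) (L.rep i)).mul (isHomogeneous_X ℂ i)
  simpa [definingPoly] using IsHomogeneous.prod A Line.form (fun _ => 1) fun L _ => h L

/-- A Jacobian relation, read as a vector field, is tangent to every line of the arrangement. -/
lemma dotProduct_eval_eq_zero_of_mem_AR {A : Finset Line} {L : Line} (hL : L ∈ A)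
    {r : Fin 3 → S} (hr : r ∈ AR (definingPoly A)) {v : Fin 3 → ℂ} (hv : L.rep ⬝ᵥ v = 0) :
    L.rep ⬝ᵥ (fun i => eval v (r i)) = 0 := by
  classical
  -- Restricted to a line `v + t q` inside `L` with `q` on no other line of `A`, the Leibniz rule
  -- leaves only the term of the relation in which the form of `L` is differentiated.
  obtain ⟨q, hq, hqA⟩ := exists_dotProduct_ne_zero A L
  have hQ : restrict v q (∏ K ∈ A.erase L, K.form) ≠ 0 :=
    restrict_prod_form_ne_zero v fun K hK =>
      hqA K (Finset.mem_of_mem_erase hK) (Finset.ne_of_mem_erase hK)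
  rw [mem_AR, definingPoly_eq_form_mul hL] at hr
  set Q := ∏ K ∈ A.erase L, K.form
  have h0 : restrict v q L.form = 0 := by simp [restrict_form, hv, hq]
  have h1 : restrict v q (∑ i, r i * C (L.rep i)) = 0 := by
    have := congrArg (restrict v q) hr
    simp only [pderiv_mul, pderiv_form, map_sum, map_mul, map_add, map_zero, h0, zero_mul,
      add_zero] at this
    refine (mul_eq_zero.mp ?_).resolve_right hQ
    rw [← this, map_sum, Finset.sum_mul]
    exact Finset.sum_congr rfl fun i _ => by rw [map_mul]; ring
  have h2 := congrArg (Polynomial.eval 0) h1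
  rw [eval_restrict] at h2
  simpa [dotProduct, mul_comm] using h2

/-- Along the intersection of two lines of the arrangement a Jacobian relation is radial. -/
lemma cross_eval_eq_zero_of_mem_AR {A : Finset Line} {K L : Line} (hK : K ∈ A) (hL : L ∈ A)
    (hKL : K ≠ L) {r : Fin 3 → S} (hr : r ∈ AR (definingPoly A)) {v : Fin 3 → ℂ}
    (hKv : K.rep ⬝ᵥ v = 0) (hLv : L.rep ⬝ᵥ v = 0) : (fun i => eval v (r i)) ⨯₃ v = 0 :=
  cross_eq_zero_of_dotProduct_eq_zero (Line.cross_rep_ne_zero hKL)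
    (dotProduct_eval_eq_zero_of_mem_AR hK hr hKv) (dotProduct_eval_eq_zero_of_mem_AR hL hr hLv)
    hKv hLv

/-- For `f = α Q` and a vector `q` in the plane `α = 0`, the derivation `Q ∂_q` multiplies `f` by
`∂_q Q`; subtracting the multiple of the Euler derivation with the same effect gives an element
of `AR(f)`. It is scaled by `deg f` to avoid denominators. -/
lemma tangentRelation_mem_AR [DecidableEq Line] {A : Finset Line} {H : Line} (hH : H ∈ A)
    {q : Fin 3 → ℂ} (hq : H.rep ⬝ᵥ q = 0) :
    (fun i => (A.card : S) * (∏ L ∈ A.erase H, L.form) * C (q i) -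
      (∑ j, C (q j) * pderiv j (∏ L ∈ A.erase H, L.form)) * X i) ∈ AR (definingPoly A) := by
  have euler := (isHomogeneous_definingPoly A).sum_X_mul_pderiv
  have hf := definingPoly_eq_form_mul hH
  rw [mem_AR]
  set Q := ∏ L ∈ A.erase H, L.form
  have hq' : ∑ j, C (q j) * pderiv j H.form = 0 := by
    simp only [pderiv_form, ← map_mul, ← map_sum]
    rw [← C_0, ← hq, dotProduct]
    simp only [mul_comm]
  have hder : ∑ j, C (q j) * pderiv j (definingPoly A) =
      H.form * ∑ j, C (q j) * pderiv j Q := by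
    rw [hf]
    simp only [Fin.sum_univ_three, pderiv_mul] at hq' ⊢
    linear_combination Q * hq'
  rw [nsmul_eq_mul] at euler
  simp only [Fin.sum_univ_three] at euler hder ⊢
  rw [hf] at euler hder ⊢
  linear_combination (A.card : S) * Q * hder -
    (C (q 0) * pderiv 0 Q + C (q 1) * pderiv 1 Q + C (q 2) * pderiv 2 Q) * euler

/-- A generating set of `AR(f)` contains a relation that is not radial along a given line `H` of
the arrangement. -/
lemma exists_restrict_cross_ne_zero {A : Finset Line} {H : Line} (hH : H ∈ A)
    {R : Set (Fin 3 → S)} (hR : Submodule.span S R = AR (definingPoly A)) {p q : Fin 3 → ℂ}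
    (hq : H.rep ⬝ᵥ q = 0) (hqA : ∀ L ∈ A, L ≠ H → L.rep ⬝ᵥ q ≠ 0) (hpq : q ⨯₃ p ≠ 0) :
    ∃ r ∈ R, ∃ k, restrict p q ((r ⨯₃ (X : Fin 3 → S)) k) ≠ 0 := by
  classical
  by_contra! hrad
  have hspan : ∀ r ∈ AR (definingPoly A), ∀ k, restrict p q ((r ⨯₃ (X : Fin 3 → S)) k) = 0 := by
    intro r hr
    rw [← hR] at hr
    induction hr using Submodule.span_induction with
    | mem r hr => exact hrad r hr
    | zero => simp
    | add r s _ _ hr hs => intro k; simp [hr k, hs k]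
    | smul c r _ hr => intro k; simp [hr k]
  obtain ⟨k, hk⟩ := Function.ne_iff.mp hpq
  have h := hspan _ (tangentRelation_mem_AR hH hq) k
  have hQ : restrict p q (∏ L ∈ A.erase H, L.form) ≠ 0 :=
    restrict_prod_form_ne_zero p fun L hL =>
      hqA L (Finset.mem_of_mem_erase hL) (Finset.ne_of_mem_erase hL)
  set Q := ∏ L ∈ A.erase H, L.form
  -- the radial part drops out of the cross product with `p + t q`, and so does `t q`
  have key : restrict p q (((fun i => (A.card : S) * Q * C (q i) -
      (∑ j, C (q j) * pderiv j Q) * X i) ⨯₃ (X : Fin 3 → S)) k) =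
      (A.card : Polynomial ℂ) * restrict p q Q * Polynomial.C ((q ⨯₃ p) k) := by
    generalize (∑ j, C (q j) * pderiv j Q) = D
    fin_cases k <;> simp [cross_apply, restrict_X] <;> ring
  rw [key] at h
  have hcard : (A.card : Polynomial ℂ) ≠ 0 := Nat.cast_ne_zero.mpr (Finset.card_ne_zero_of_mem hH)
  exact mul_ne_zero (mul_ne_zero hcard hQ) (Polynomial.C_ne_zero.mpr hk) h

/-! ### Counting multiple points -/

/-- If `AR(f)` is generated by homogeneous relations of degree at most `e`, then every line of the
arrangement carries at most `e + 1` multiple points. -/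
theorem encard_multiplePointsOn_le {A : Finset Line} {H : Line} (hH : H ∈ A)
    {R : Set (Fin 3 → S)} (hR : Submodule.span S R = AR (definingPoly A)) {e : ℕ}
    (hdeg : ∀ r ∈ R, ∃ m ≤ e, ∀ i, (r i).IsHomogeneous m) :
    (multiplePointsOn A H).encard ≤ (e : ℕ∞) + 1 := by
  rcases (multiplePointsOn A H).eq_empty_or_nonempty with hempty | ⟨p₀, hp₀⟩
  · simp [hempty]
  have second {p : Plane} (hp : p ∈ multiplePointsOn A H) :
      ∃ L ∈ A, L ≠ H ∧ L.rep ⬝ᵥ p.rep = 0 := by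
    obtain ⟨-, K, hK, L, hL, hKL, hKp, hLp⟩ := hp
    by_cases h : K = H
    · exact ⟨L, hL, fun h' => hKL (h.trans h'.symm), (L.through_iff p).mp hLp⟩
    · exact ⟨K, hK, h, (K.through_iff p).mp hKp⟩
  obtain ⟨q, hq, hqA⟩ := exists_dotProduct_ne_zero A H
  have hq0 : q ≠ 0 := by
    -- a multiple point on `H` provides a second line, so that the genericity of `q` has content
    rintro rfl
    obtain ⟨L, hL, hLH, -⟩ := second hp₀
    exact hqA L hL hLH (dotProduct_zero _)
  obtain ⟨p, hp, hpq⟩ := exists_cross_ne_zero H.rep_nonzero hq0 hq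
  have hne (t : ℂ) : p + t • q ≠ 0 := fun h => hpq (by
    rw [eq_neg_of_add_eq_zero_left h]
    simp)
  obtain ⟨r, hr, k, hk⟩ := exists_restrict_cross_ne_zero hH hR hq hqA hpq
  obtain ⟨m, hm, hrm⟩ := hdeg r hr
  set G := restrict p q ((r ⨯₃ (X : Fin 3 → S)) k) with hG
  have hGdeg : G.natDegree ≤ e + 1 := by
    have := aeval_natDegree_le _ (isHomogeneous_cross_X hrm k).totalDegree_le
      (fun i => Polynomial.C (p i) + Polynomial.C (q i) * Polynomial.X) (n := 1) fun i => by
        compute_degree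
    have h' : G.natDegree ≤ (m + 1) * 1 := this
    omega
  -- `[p + t q]` runs through all points of `H` but `[q]`, which is not a multiple point
  have hsub : multiplePointsOn A H ⊆
      (fun t => Projectivization.mk ℂ (p + t • q) (hne t)) '' (G.roots.toFinset : Set ℂ) := by
    intro x hx
    obtain ⟨L, hL, hLH, hLx⟩ := second hx
    have hHx := (H.through_iff x).mp hx.1
    obtain ⟨s, u, hsu⟩ := exists_eq_smul_add_smul H.rep_nonzero hpq hp hq hHx
    have hs : s ≠ 0 := by
      rintro rfl
      rw [zero_smul, zero_add] at hsu
      rw [hsu, dotProduct_smul, smul_eq_mul] at hLx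
      have hu := (mul_eq_zero.mp hLx).resolve_right (hqA L hL hLH)
      exact x.rep_nonzero (by rw [hsu, hu, zero_smul])
    have hxt : s • (p + (u / s) • q) = x.rep := by
      rw [hsu, smul_add, smul_smul, mul_div_cancel₀ u hs]
    have hLt : L.rep ⬝ᵥ (p + (u / s) • q) = 0 := by
      rw [← hxt, dotProduct_smul, smul_eq_mul] at hLx
      exact (mul_eq_zero.mp hLx).resolve_left hs
    have hHt : H.rep ⬝ᵥ (p + (u / s) • q) = 0 := by
      rw [dotProduct_add, dotProduct_smul, hp, hq, smul_zero, add_zero]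
    refine ⟨u / s, ?_, ?_⟩
    · have hcross := cross_eval_eq_zero_of_mem_AR hH hL hLH.symm
        (hR ▸ Submodule.subset_span hr) hHt hLt
      have hroot : G.eval (u / s) = 0 := by
        rw [hG, eval_restrict, map_cross]
        simp only [eval_X]
        exact congrFun hcross k
      simpa using ⟨hk, hroot⟩
    · conv_rhs => rw [← x.mk_rep]
      exact (Projectivization.mk_eq_mk_iff' ℂ _ _ _ _).mpr
        ⟨s⁻¹, by rw [← hxt, smul_smul, inv_mul_cancel₀ hs, one_smul]⟩
  calc (multiplePointsOn A H).encard
      ≤ (G.roots.toFinset : Set ℂ).encard :=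
        (Set.encard_le_encard hsub).trans (Set.encard_image_le _ _)
    _ ≤ ((e + 1 : ℕ) : ℕ∞) := by
        rw [Set.encard_coe_eq_coe_finsetCard, Nat.cast_le]
        exact (Multiset.toFinset_card_le _).trans (G.card_roots'.trans hGdeg)
    _ = (e : ℕ∞) + 1 := by push_cast; rfl

end LineArrangement

theorem proposition4p6 (A : Finset LineArrangement.Line) (d₁ d₂ : ℕ)
    (hA : LineArrangement.NearlyFree A) (hexp : LineArrangement.HasNearExponents A d₁ d₂)
    (H : LineArrangement.Line) (hH : H ∈ A) :
    (LineArrangement.multiplePointsOn A H).encard ≤ (d₂ : ℕ∞) + 1 := by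
  obtain ⟨hd, r, hhom, hspan, -⟩ := hexp
  refine LineArrangement.encard_multiplePointsOn_le hH hspan ?_
  rintro _ ⟨j, rfl⟩
  refine ⟨![d₁, d₂, d₂] j, ?_, hhom j⟩
  fin_cases j
  exacts [hd, le_rfl, le_rfl]
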